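/- Let $\Omega\subset\mathbb R^2$ be a bounded open set, $\nu>0$, $V=H^1_0(\Omega)^2$, $Q=\{q\in L^2(\Omega):\int_\Omega q=0\}$, and put $$a(u,v)=\int_\Omega \nu\,\mathbb D(u):\mathbb D(v),\qquad b(u,w,v)=\int_\Omega (u\cdot\nabla)w\cdot v,\qquad \mathbb D(u)=\tfrac12(\nabla u+\nabla^Tu).$$ Let $V_h\times Q_h\subset V\times Q$ be finite-dimensional spaces satisfying the inf-sup condition, let $\phi_1,\dots,\phi_m$ be a basis of $V_h$, and write $\vec v\in\mathbb R^m$ for the coefficient vector of $v\in V_h$. Let $V_h^{div}=\{v\in V_h:(q,\nabla\cdot v)=0\ \forall q\in Q_h\}$. Let $\tau>0$, $T=n\tau$, $f^j\in H^{-1}(\Omega)^2$ and $\hat u^j\in L^2(\Omega)^2$ $(1\le j\le n)$, $u_{0,h}\in L^2(\Omega)^2$, $\gamma\in\mathbb R$. Forward problem: let $u_h^0=u_{0,h}$ and let $u_h^1,\dots,u_h^n\in V_h^{div}$ satisfy, for $0\le j<n$ and all $v\in V_h^{div}$, $$\Big\langle \tfrac{u_h^{j+1}-u_h^j}{\tau},v\Big\rangle+a(u_h^{j+1},v)+b(u_h^{j+1},u_h^{j+1},v)=\langle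 f^{j+1},v\rangle .$$ Adjoint problem with data $w^1,\dots,w^n\in V_h$: find $w^{*0},\dots,w^{*n}\in V_h$ and $p^{*0},\dots,p^{*(n-1)}\in Q_h$ such that $w^{*n}=0$ and, for $0\le j<n$, all $v\in V_h$ and all $q\in Q_h$, $$\Big\langle -\tfrac{w^{*(j+1)}-w^{*j}}{\tau},v\Big\rangle+a(w^{*j},v)+b(v,w^{j+1},w^{*j})+b(w^{j+1},v,w^{*j})+(p^{*j},\nabla\cdot v)=\langle \hat u^{j+1}-w^{j+1},v\rangle,\qquad (\nabla\cdot w^{*j},q)=0 .$$ The gradient computed from its solution is $-w^{*0}+\gamma u_{0,h}$. Let $M_{ij}=(\phi_j,\phi_i)_{H^1(\Omega)}$ and $U=[\tau^{1/2}\vec u_h^1\ \cdots\ \tau^{1/2}\vec u_h^n]:\mathbb R^n\to\mathbb R^m_M$, where $\mathbb R^m_M$ carries the inner product $y^TMx$. Let $\widetilde U=[\tau^{1/2}\vec u_{h,r}^1\ \cdots\ \tau^{1/2}\vec u_{h,r}^n]$ be the matrix that incremental POD (iPOD) with weight $M$ and thresholds $\mathtt{tol}_p,\mathtt{tol}_{sv}>0$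 returns for $U$: iPOD starts with the first column of $U$; given the current approximation $A=V\Sigma W^T$ (core $M$-weighted SVD: $V^TMV=I$, $W^TW=I$, $\Sigma$ diagonal with positive non-increasing entries) and the next column $\vec u$, put $p=\|\vec u-VV^TM\vec u\|_{\mathbb R^m_M}$; if $p<\mathtt{tol}_p$, the next approximation is $[A\ \ VV^TM\vec u]$; otherwise it is $[A\ \ \vec u]$, from whose core $M$-weighted SVD the smallest singular value and its singular vectors are removed if that singular value is $<\mathtt{tol}_{sv}$. Assume $\|U-\widetilde U\|_{\rm HS}\le\epsilon$. Let $\{u_h^{*j}\}$ and $\{u_{h,r}^{*j}\}$ be the velocities of solutions of the adjoint problem with data $\{u_h^j\}$ and $\{u_{h,r}^j\}$, and let $\xi$ be the difference of the two gradients computed from them. Then there are positive functions $\tau_0,C_3,C_4$ of a real variable that depend only on $\Omega$ and $\nu$ such that, whenever $\max_{1\le j\le n}\|\nabla u_{h,r}^j\|_{L^2(\Omega)}\le B$, $\max_{0\le j\le n}\|\nabla u_h^{*j}\|_{L^2(\Omega)}\le B'$, $\max_{0\le j\le n}\|\nabla u_{h,r}^{*j}\|_{L^2(\Omega)}\le B'$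 and $\tau\le\tau_0(B)$, $$\|\xi\|_{L^2(\Omega)}\le\sqrt{C_4(B')\,e^{C_3(B)T}}\ \epsilon .$$ -/

import Mathlib

open MeasureTheory

open scoped ContDiff

noncomputable section

namespace NSCompress

/-! ### Sobolev spaces on a planar open set -/

/-- The Euclidean plane. -/
abbrev Plane : Type := EuclideanSpace ℝ (Fin 2)

/-- `L²(Ω)`. -/
abbrev L2 (Ω : Set Plane) : Type := Lp ℝ 2 ((volume : Measure Plane).restrict Ω)

/-- `φ ∈ C_c^∞(Ω)`. -/
def IsTest (Ω : Set Plane) (φ : Plane → ℝ) : Prop :=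
  ContDiff ℝ ∞ φ ∧ HasCompactSupport φ ∧ tsupport φ ⊆ Ω

/-- The classical partial derivative `∂_k φ`. -/
def pderiv (k : Fin 2) (φ : Plane → ℝ) (x : Plane) : ℝ :=
  fderiv ℝ φ x (EuclideanSpace.single k 1)

/-- `g` is the weak partial derivative `∂_k u` on `Ω`. -/
def HasWeakPartial (Ω : Set Plane) (k : Fin 2) (u g : L2 Ω) : Prop :=
  ∀ φ : Plane → ℝ, IsTest Ω φ →
    ∫ x in Ω, u x * pderiv k φ x = -∫ x in Ω, g x * φ x

lemma IsTest.memLp {Ω : Set Plane} {φ : Plane → ℝ} (h : IsTest Ω φ) :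
    MemLp φ 2 ((volume : Measure Plane).restrict Ω) :=
  (h.1.continuous.memLp_of_hasCompactSupport h.2.1)

lemma IsTest.memLp_pderiv {Ω : Set Plane} {φ : Plane → ℝ} (h : IsTest Ω φ) (k : Fin 2) :
    MemLp (pderiv k φ) 2 ((volume : Measure Plane).restrict Ω) := by
  have hc : Continuous (pderiv k φ) :=
    (h.1.continuous_fderiv (by simp)).clm_apply continuous_const
  have hs : HasCompactSupport (pderiv k φ) := h.2.1.fderiv_apply ℝ (EuclideanSpace.single k 1)
  exact hc.memLp_of_hasCompactSupport hs

lemma integrable_mul {Ω : Set Plane} (u : L2 Ω) {φ : Plane → ℝ}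
    (h : MemLp φ 2 ((volume : Measure Plane).restrict Ω)) :
    Integrable (fun x => u x * φ x) ((volume : Measure Plane).restrict Ω) :=
  (Lp.memLp u).integrable_mul h

lemma integral_add_mul {Ω : Set Plane} (u v : L2 Ω) {φ : Plane → ℝ}
    (h : MemLp φ 2 ((volume : Measure Plane).restrict Ω)) :
    ∫ x in Ω, (u + v : L2 Ω) x * φ x = (∫ x in Ω, u x * φ x) + ∫ x in Ω, v x * φ x := by
  rw [← integral_add (integrable_mul u h) (integrable_mul v h)]
  refine integral_congr_ae ?_
  filter_upwards [Lp.coeFn_add u v] with x hx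
  rw [hx, Pi.add_apply, add_mul]

lemma integral_smul_mul {Ω : Set Plane} (c : ℝ) (u : L2 Ω) (φ : Plane → ℝ) :
    ∫ x in Ω, (c • u : L2 Ω) x * φ x = c * ∫ x in Ω, u x * φ x := by
  rw [← integral_const_mul]
  refine integral_congr_ae ?_
  filter_upwards [Lp.coeFn_smul c u] with x hx
  rw [hx, Pi.smul_apply, smul_eq_mul, mul_assoc]

/-- `H¹(Ω)`: a function in `L²(Ω)` together with its (unique) weak gradient in `L²(Ω)²`. Its
topology, inherited from the product, is that of the `H¹` norm. -/
def H1 (Ω : Set Plane) : Submodule ℝ (L2 Ω × (Fin 2 → L2 Ω)) where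
  carrier := {w | ∀ k, HasWeakPartial Ω k w.1 (w.2 k)}
  add_mem' {a b} ha hb k φ hφ := by
    have h1 := ha k φ hφ
    have h2 := hb k φ hφ
    simp only [Prod.fst_add, Prod.snd_add, Pi.add_apply]
    rw [integral_add_mul _ _ (hφ.memLp_pderiv k), integral_add_mul _ _ hφ.memLp, h1, h2]
    ring
  zero_mem' k φ _ := by
    have h (ψ : Plane → ℝ) : ∫ x in Ω, (0 : L2 Ω) x * ψ x = 0 := by
      have := integral_smul_mul (0 : ℝ) (0 : L2 Ω) ψ
      simpa only [smul_zero, zero_mul] using this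
    simp only [Prod.fst_zero, Prod.snd_zero, Pi.zero_apply]
    rw [h, h, neg_zero]
  smul_mem' c a ha k φ hφ := by
    have h1 := ha k φ hφ
    simp only [Prod.smul_fst, Prod.smul_snd, Pi.smul_apply]
    rw [integral_smul_mul, integral_smul_mul, h1]
    ring

/-- `H¹₀(Ω)`: the closure of `C_c^∞(Ω)` in `H¹(Ω)`. -/
def H10 (Ω : Set Plane) : Submodule ℝ (L2 Ω × (Fin 2 → L2 Ω)) :=
  H1 Ω ⊓ (Submodule.span ℝ {w : L2 Ω × (Fin 2 → L2 Ω) | ∃ φ : Plane → ℝ, IsTest Ω φ ∧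
    (∀ᵐ x ∂((volume : Measure Plane).restrict Ω), w.1 x = φ x) ∧
    ∀ k, ∀ᵐ x ∂((volume : Measure Plane).restrict Ω), w.2 k x = pderiv k φ x}).topologicalClosure

/-- Velocity fields: `H¹₀(Ω)²`. -/
abbrev Vel (Ω : Set Plane) : Type := Fin 2 → H10 Ω

/-- `L²(Ω)²`. -/
abbrev VecL2 (Ω : Set Plane) : Type := Fin 2 → L2 Ω

variable {Ω : Set Plane}

/-- A velocity field as an element of `L²(Ω)²`. -/
def Vel.val (u : Vel Ω) : VecL2 Ω := fun i => (u i).1.1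

/-- `∂_k u_i`. -/
def Vel.part (u : Vel Ω) (i k : Fin 2) : L2 Ω := (u i).1.2 k

/-- `∇ · u`. -/
def Vel.div (u : Vel Ω) : L2 Ω := ∑ i, u.part i i

/-- The entries of the deformation tensor `𝔻(u) = (∇u + ∇ᵀu) / 2`. -/
def Vel.deform (u : Vel Ω) (i k : Fin 2) : L2 Ω := (1 / 2 : ℝ) • (u.part i k + u.part k i)

/-- The inner product of `L²(Ω)`. -/
def ip (p q : L2 Ω) : ℝ := ∫ x in Ω, p x * q x

/-- The inner product of `L²(Ω)²`. -/
def vip (u v : VecL2 Ω) : ℝ := ∑ i, ip (u i) (v i)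

/-- The norm of `L²(Ω)²`. -/
def vnorm (u : VecL2 Ω) : ℝ := √(vip u u)

/-- The inner product of `H¹(Ω)²`. -/
def h1ip (u v : Vel Ω) : ℝ := vip u.val v.val + ∑ i, ∑ k, ip (u.part i k) (v.part i k)

/-- `‖∇u‖_{L²(Ω)}`. -/
def gradNorm (u : Vel Ω) : ℝ := √(∑ i, ∑ k, ip (u.part i k) (u.part i k))

/-- `a(u, v) = ∫ ν 𝔻(u) : 𝔻(v)`. -/
def aForm (ν : ℝ) (u v : Vel Ω) : ℝ := ν * ∑ i, ∑ k, ip (u.deform i k) (v.deform i k)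

/-- `b(u, w, v) = ∫ (u · ∇) w · v`. -/
def bForm (u w v : Vel Ω) : ℝ :=
  ∑ i, ∑ k, ∫ x in Ω, u.val k x * w.part i k x * v.val i x

/-! ### The discrete problems -/

/-- A conforming, inf-sup stable pair of finite-dimensional spaces `V_h ⊂ H¹₀(Ω)²` and
`Q_h ⊂ {q ∈ L²(Ω) : ∫ q = 0}`, with a basis `φ` of `V_h`. -/
structure StablePair (Ω : Set Plane) where
  Vh : Submodule ℝ (Vel Ω)
  Qh : Submodule ℝ (L2 Ω)
  m : ℕ
  φ : Module.Basis (Fin m) ℝ Vh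
  finite_Qh : FiniteDimensional ℝ Qh
  mean_zero : ∀ q ∈ Qh, ∫ x in Ω, q x = 0
  inf_sup : ∃ β : ℝ, 0 < β ∧ ∀ q ∈ Qh, q ≠ 0 →
    ∃ v ∈ Vh, v ≠ 0 ∧ β * ‖q‖ * gradNorm v ≤ ip q v.div

/-- Membership in `V_h^div` of an element of `V_h`. -/
def StablePair.DivFree (S : StablePair Ω) (v : S.Vh) : Prop :=
  ∀ q ∈ S.Qh, ip q v.1.div = 0

/-- The backward Euler finite element scheme for the Navier-Stokes equations on `V_h^div`, with
forcing terms `f j ∈ H⁻¹(Ω)²` and initial value `u₀ ∈ L²(Ω)²`. The solution is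
`u 1, …, u n`; the other values of `u` are irrelevant. -/
structure IsForward (S : StablePair Ω) (ν τ : ℝ) (n : ℕ) (f : ℕ → (Vel Ω →L[ℝ] ℝ))
    (u₀ : VecL2 Ω) (u : ℕ → S.Vh) : Prop where
  divFree : ∀ j < n, S.DivFree (u (j + 1))
  step : ∀ j < n, ∀ v : S.Vh, S.DivFree v →
    vip (τ⁻¹ • ((u (j + 1)).1.val - if j = 0 then u₀ else (u j).1.val)) v.1.val
      + aForm ν (u (j + 1)).1 v.1 + bForm (u (j + 1)).1 (u (j + 1)).1 v.1 = f (j + 1) v.1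

/-- The backward adjoint equation with observations `û j` and velocities `u 1, …, u n`; its solution
consists of the adjoint velocities `us 0, …, us n` and the adjoint pressures
`ps 0, …, ps (n - 1)`. -/
structure IsAdjoint (S : StablePair Ω) (ν τ : ℝ) (n : ℕ) (û : ℕ → VecL2 Ω)
    (u : ℕ → S.Vh) (us : ℕ → S.Vh) (ps : ℕ → L2 Ω) : Prop where
  pressure_mem : ∀ j < n, ps j ∈ S.Qh
  terminal : us n = 0
  divFree : ∀ j < n, S.DivFree (us j)
  step : ∀ j < n, ∀ v : S.Vh,
    vip (-(τ⁻¹ • ((us (j + 1)).1.val - (us j).1.val))) v.1.val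
      + aForm ν (us j).1 v.1
      + bForm v.1 (u (j + 1)).1 (us j).1
      + bForm (u (j + 1)).1 v.1 (us j).1
      + ip (ps j) v.1.div
    = vip (û (j + 1) - (u (j + 1)).1.val) v.1.val

/-- The gradient `- u^{*0} + γ u₀` computed from the initial adjoint velocity. -/
def gradJ (γ : ℝ) (u₀ : VecL2 Ω) (us0 : Vel Ω) : VecL2 Ω := -us0.val + γ • u₀

/-- The weight matrix induced on coefficient vectors by the `H¹(Ω)` inner product. -/
def StablePair.weight (S : StablePair Ω) : Matrix (Fin S.m) (Fin S.m) ℝ :=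
  fun i j => h1ip (S.φ j).1 (S.φ i).1

/-- The matrix with columns `τ^{1/2}` times the coefficient vector of `u j`, `j = 1, …, n`. -/
def StablePair.dataMatrix (S : StablePair Ω) (τ : ℝ) (n : ℕ) (u : ℕ → S.Vh) :
    Matrix (Fin S.m) (Fin n) ℝ :=
  fun i j => √τ * S.φ.repr (u (j + 1)) i

end NSCompress

/-! ### Incremental POD in a weighted Euclidean space -/

namespace NSCompress

variable {m n s : ℕ}

/-- The norm of `ℝ^m_M`. -/
def wnorm (M : Matrix (Fin m) (Fin m) ℝ) (x : Fin m → ℝ) : ℝ := √(x ⬝ᵥ M.mulVec x)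

/-- The Hilbert-Schmidt norm of `A : ℝ^n → ℝ^m_M`, evaluated on the standard basis of `ℝ^n`. -/
def hsNorm (M : Matrix (Fin m) (Fin m) ℝ) (A : Matrix (Fin m) (Fin n) ℝ) : ℝ :=
  √(∑ j, wnorm M (A.mulVec (Pi.single j 1)) ^ 2)

/-- `A = V Σ Wᵀ` is a core `M`-weighted singular value decomposition. -/
structure IsCoreSVD (M : Matrix (Fin m) (Fin m) ℝ) (A : Matrix (Fin m) (Fin n) ℝ)
    (V : Matrix (Fin m) (Fin s) ℝ) (σ : Fin s → ℝ) (W : Matrix (Fin n) (Fin s) ℝ) : Prop where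
  eq : A = V * Matrix.diagonal σ * W.transpose
  left : V.transpose * M * V = 1
  right : W.transpose * W = 1
  pos : ∀ i, 0 < σ i
  anti : Antitone σ

/-- The matrix `[A  u]`. -/
def appendCol (A : Matrix (Fin m) (Fin n) ℝ) (u : Fin m → ℝ) : Matrix (Fin m) (Fin (n + 1)) ℝ :=
  fun i => Fin.snoc (α := fun _ => ℝ) (A i) (u i)

/-- `V V* u`, where `V* = Vᵀ M`. -/
def proj (M : Matrix (Fin m) (Fin m) ℝ) (V : Matrix (Fin m) (Fin s) ℝ) (u : Fin m → ℝ) :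
    Fin m → ℝ :=
  (V * (V.transpose * M)).mulVec u

/-- The first `s` columns of a matrix with `s + 1` columns. -/
def dropLast {k : ℕ} (V : Matrix (Fin k) (Fin (s + 1)) ℝ) : Matrix (Fin k) (Fin s) ℝ :=
  fun i j => V i j.castSucc

/-- `IPOD M tolp tolsv U A`: processing the columns of `U` one after the other, incremental POD with
weight `M`, threshold `tolp` for the `p`-truncation and threshold `tolsv` for the truncation of the
smallest singular value returns (the factors of) the matrix `A`. -/
inductive IPOD (M : Matrix (Fin m) (Fin m) ℝ) (tolp tolsv : ℝ) :
    {n : ℕ} → Matrix (Fin m) (Fin n) ℝ → Matrix (Fin m) (Fin n) ℝ → Prop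
  /-- Initialization with the first column. -/
  | init (U : Matrix (Fin m) (Fin 1) ℝ) : IPOD M tolp tolsv U U
  /-- The new column is almost dependent on `V` and is replaced by its projection. -/
  | pTrunc {n s : ℕ} {U A : Matrix (Fin m) (Fin n) ℝ} (u : Fin m → ℝ)
      {V : Matrix (Fin m) (Fin s) ℝ} {σ : Fin s → ℝ} {W : Matrix (Fin n) (Fin s) ℝ}
      (h : IPOD M tolp tolsv U A) (hA : IsCoreSVD M A V σ W)
      (hp : wnorm M (u - proj M V u) < tolp) :
      IPOD M tolp tolsv (appendCol U u) (appendCol A (proj M V u))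
  /-- The smallest singular value of the extended matrix is small and is discarded. -/
  | svTrunc {n s : ℕ} {U A : Matrix (Fin m) (Fin n) ℝ} (u : Fin m → ℝ)
      {V : Matrix (Fin m) (Fin s) ℝ} {σ : Fin s → ℝ} {W : Matrix (Fin n) (Fin s) ℝ}
      {V' : Matrix (Fin m) (Fin (s + 1)) ℝ} {μ : Fin (s + 1) → ℝ}
      {W' : Matrix (Fin (n + 1)) (Fin (s + 1)) ℝ}
      (h : IPOD M tolp tolsv U A) (hA : IsCoreSVD M A V σ W)
      (hp : tolp ≤ wnorm M (u - proj M V u))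
      (hA' : IsCoreSVD M (appendCol A u) V' μ W') (hμ : μ (Fin.last s) < tolsv) :
      IPOD M tolp tolsv (appendCol U u)
        (dropLast V' * Matrix.diagonal (fun i : Fin s => μ i.castSucc) * (dropLast W').transpose)
  /-- No truncation. -/
  | exact {n s : ℕ} {U A : Matrix (Fin m) (Fin n) ℝ} (u : Fin m → ℝ)
      {V : Matrix (Fin m) (Fin s) ℝ} {σ : Fin s → ℝ} {W : Matrix (Fin n) (Fin s) ℝ}
      {V' : Matrix (Fin m) (Fin (s + 1)) ℝ} {μ : Fin (s + 1) → ℝ}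
      {W' : Matrix (Fin (n + 1)) (Fin (s + 1)) ℝ}
      (h : IPOD M tolp tolsv U A) (hA : IsCoreSVD M A V σ W)
      (hp : tolp ≤ wnorm M (u - proj M V u))
      (hA' : IsCoreSVD M (appendCol A u) V' μ W') (hμ : tolsv ≤ μ (Fin.last s)) :
      IPOD M tolp tolsv (appendCol U u) (appendCol A u)

end NSCompress

end

open NSCompress

/-! Both adjoint solutions solve the same linear scheme with different data, so their difference `δ`
satisfies an adjoint equation whose source terms are linear in the data error `e = u - u_r`. Tested
with `δ` itself the pressures vanish, since both adjoint velocities are discretely divergence free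
(`IsAdjoint.difference_equation`). The convective terms split as
`b(δ, e, u*) + b(δ, u_r, δ) + b(e, δ, u*) + b(u_r, δ, δ)`; the first and third are sources, bounded by
`‖∇e‖ ‖∇δ‖ B'`, while the other two involve only `u_r` and are controlled by `B`. Discretely
divergence free fields are not divergence free, so `b(u_r, δ, δ)` does not vanish and must be
estimated.

Three facts about `H¹₀(Ω)` are used, each proved for test functions and carried over by density
(`H10.closed_induction`): the Poincaré inequality (`exists_poincare`), Korn's inequality
(`half_gradNorm_sq_le_deform`), and Ladyzhenskaya's inequality `‖u²‖ ≲ ‖u‖ ‖∇u‖` in `L²`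
(`H10.exists_eLpNorm_sq_le`), which comes from the Gagliardo-Nirenberg-Sobolev inequality
`‖φ‖_{L²} ≲ ‖∇φ‖_{L¹}` in the plane applied to the square of a test function. Ladyzhenskaya's
inequality yields `|b(u, w, v)| ≲ (‖u‖ ‖∇u‖)^{1/2} ‖∇w‖ (‖v‖ ‖∇v‖)^{1/2}` (`exists_bForm_le`), so that
the terms quadratic in `δ` can be absorbed into the viscous term at the price of a multiple of `‖δ‖²`.

The resulting inequality between consecutive time steps (`IsAdjoint.energy_step`) is summed by a
backward discrete Gronwall argument starting from `δ = 0` at the final time, and the sum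
`∑ τ ‖∇e‖²` is at most the squared Hilbert-Schmidt distance of the two data matrices
(`StablePair.sum_gradNorm_sq_le_hsNorm_sq`), since the weight matrix represents the `H¹` norm. -/

open Filter Topology

namespace NSCompress

variable {Ω : Set Plane}

/-! ### Test functions and density -/

/-- `w` consists of (the classes of) a test function on `Ω` and its classical gradient. These pairs
span, and in fact form, the subspace whose closure defines `H¹₀(Ω)`. -/
def IsTestPair (Ω : Set Plane) (w : L2 Ω × (Fin 2 → L2 Ω)) : Prop :=
  ∃ φ : Plane → ℝ, IsTest Ω φ ∧
    (∀ᵐ x ∂((volume : Measure Plane).restrict Ω), w.1 x = φ x) ∧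
    ∀ k, ∀ᵐ x ∂((volume : Measure Plane).restrict Ω), w.2 k x = pderiv k φ x

lemma IsTest.add {φ ψ : Plane → ℝ} (hφ : IsTest Ω φ) (hψ : IsTest Ω ψ) :
    IsTest Ω (fun x => φ x + ψ x) :=
  ⟨hφ.1.add hψ.1, hφ.2.1.add hψ.2.1,
    (tsupport_add φ ψ).trans (Set.union_subset hφ.2.2 hψ.2.2)⟩

lemma IsTest.const_mul {φ : Plane → ℝ} (hφ : IsTest Ω φ) (c : ℝ) :
    IsTest Ω (fun x => c * φ x) :=
  ⟨contDiff_const.mul hφ.1, hφ.2.1.mul_left (f := fun _ => c),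
    (tsupport_mul_subset_right (f := fun _ => c)).trans hφ.2.2⟩

lemma IsTest.mul {φ ψ : Plane → ℝ} (hφ : IsTest Ω φ) (hψ : IsTest Ω ψ) :
    IsTest Ω (fun x => φ x * ψ x) :=
  ⟨hφ.1.mul hψ.1, hφ.2.1.mul_right, (tsupport_mul_subset_left).trans hφ.2.2⟩

lemma IsTest.differentiable {φ : Plane → ℝ} (hφ : IsTest Ω φ) : Differentiable ℝ φ :=
  hφ.1.differentiable (by simp)

lemma IsTest.isTest_pderiv {φ : Plane → ℝ} (hφ : IsTest Ω φ) (k : Fin 2) :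
    IsTest Ω (pderiv k φ) :=
  ⟨(hφ.1.fderiv_right (m := ∞) (by simp)).clm_apply contDiff_const,
    hφ.2.1.fderiv_apply ℝ (EuclideanSpace.single k 1),
    (tsupport_fderiv_apply_subset ℝ _).trans hφ.2.2⟩

lemma pderiv_add {φ ψ : Plane → ℝ} (hφ : Differentiable ℝ φ) (hψ : Differentiable ℝ ψ)
    (k : Fin 2) (x : Plane) :
    pderiv k (fun x => φ x + ψ x) x = pderiv k φ x + pderiv k ψ x := by
  simp [pderiv, fderiv_fun_add (hφ x) (hψ x)]

lemma pderiv_const_mul {φ : Plane → ℝ} (hφ : Differentiable ℝ φ) (c : ℝ)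
    (k : Fin 2) (x : Plane) :
    pderiv k (fun x => c * φ x) x = c * pderiv k φ x := by
  simp [pderiv, fderiv_const_mul (hφ x) c]

lemma pderiv_mul {φ ψ : Plane → ℝ} (hφ : Differentiable ℝ φ) (hψ : Differentiable ℝ ψ)
    (k : Fin 2) (x : Plane) :
    pderiv k (fun x => φ x * ψ x) x = φ x * pderiv k ψ x + ψ x * pderiv k φ x := by
  simp [pderiv, fderiv_fun_mul (hφ x) (hψ x)]

lemma isTestPair_of_mem_span {w : L2 Ω × (Fin 2 → L2 Ω)}
    (hw : w ∈ Submodule.span ℝ {w | IsTestPair Ω w}) : IsTestPair Ω w := by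
  induction hw using Submodule.span_induction with
  | mem w h => exact h
  | zero =>
    refine ⟨fun _ => 0, ⟨contDiff_const, HasCompactSupport.zero, by simp [tsupport]⟩,
      Lp.coeFn_zero _ _ _, fun k => ?_⟩
    filter_upwards [Lp.coeFn_zero ℝ 2 ((volume : Measure Plane).restrict Ω)] with x hx
    simpa [pderiv] using hx
  | add w w' _ _ h h' =>
    obtain ⟨φ, hφ, h1, h2⟩ := h
    obtain ⟨ψ, hψ, h1', h2'⟩ := h'
    refine ⟨_, hφ.add hψ, ?_, fun k => ?_⟩
    · filter_upwards [Lp.coeFn_add w.1 w'.1, h1, h1'] with x hx ha hb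
      rw [Prod.fst_add, hx, Pi.add_apply, ha, hb]
    · filter_upwards [Lp.coeFn_add (w.2 k) (w'.2 k), h2 k, h2' k] with x hx ha hb
      rw [Prod.snd_add, Pi.add_apply, hx, Pi.add_apply, ha, hb,
        pderiv_add hφ.differentiable hψ.differentiable]
  | smul c w _ h =>
    obtain ⟨φ, hφ, h1, h2⟩ := h
    refine ⟨_, hφ.const_mul c, ?_, fun k => ?_⟩
    · filter_upwards [Lp.coeFn_smul c w.1, h1] with x hx ha
      rw [Prod.smul_fst, hx, Pi.smul_apply, ha, smul_eq_mul]
    · filter_upwards [Lp.coeFn_smul c (w.2 k), h2 k] with x hx ha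
      rw [Prod.smul_snd, Pi.smul_apply, hx, Pi.smul_apply, ha, smul_eq_mul,
        pderiv_const_mul hφ.differentiable]

/-- Density of test functions, as an induction principle: a closed property of pairs `(u, ∇u)` that
holds for test functions holds on `H¹₀(Ω)`. -/
lemma H10.closed_induction {P : L2 Ω × (Fin 2 → L2 Ω) → Prop} (hP : IsClosed {w | P w})
    (h : ∀ w, IsTestPair Ω w → P w) (w : H10 Ω) : P w.1 := by
  have hw := w.2.2
  refine closure_minimal ?_ hP hw
  intro v hv
  exact h v (isTestPair_of_mem_span hv)

/-! ### Integration by parts and the Sobolev inequality for test functions -/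

lemma ip_eq_inner (p q : L2 Ω) : ip p q = inner ℝ p q := by
  rw [L2.inner_def]
  refine integral_congr_ae (ae_of_all _ fun x => ?_)
  simp [mul_comm]

/-- Two integrations by parts and the symmetry of second derivatives. -/
lemma integral_pderiv_mul_pderiv_comm {φ ψ : Plane → ℝ} (hφ : IsTest Ω φ) (hψ : IsTest Ω ψ)
    (i k : Fin 2) :
    ∫ x, pderiv k φ x * pderiv i ψ x = ∫ x, pderiv i φ x * pderiv k ψ x := by
  have hint : ∀ {f g : Plane → ℝ}, IsTest Ω f → IsTest Ω g → Integrable (fun x => f x * g x) :=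
    fun hf hg => (hf.mul hg).1.continuous.integrable_of_hasCompactSupport (hf.mul hg).2.1
  have key : ∀ {f g : Plane → ℝ}, IsTest Ω f → IsTest Ω g → ∀ k,
      ∫ x, f x * pderiv k g x = -∫ x, pderiv k f x * g x := fun hf hg k =>
    integral_mul_fderiv_eq_neg_fderiv_mul_of_integrable (hint (hf.isTest_pderiv k) hg)
      (hint hf (hg.isTest_pderiv k)) (hint hf hg) (fun x _ => hf.differentiable x)
      (fun x _ => hg.differentiable x)
  have hsymm : ∀ x, pderiv i (pderiv k φ) x = pderiv k (pderiv i φ) x := by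
    intro x
    have hs : IsSymmSndFDerivAt ℝ φ x :=
      (hφ.1.contDiffAt (x := x)).isSymmSndFDerivAt (by simp; exact WithTop.coe_le_coe.2 le_top)
    have hd : DifferentiableAt ℝ (fderiv ℝ φ) x :=
      (hφ.1.fderiv_right (m := ∞) (by simp)).differentiable (by simp) x
    have h2 : ∀ a b : Plane, fderiv ℝ (fun y => fderiv ℝ φ y a) x b
        = fderiv ℝ (fderiv ℝ φ) x b a := by
      intro a b
      rw [fderiv_clm_apply hd (differentiableAt_const a)]
      simp
    exact (h2 _ _).trans ((hs _ _).trans (h2 _ _).symm)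
  rw [key (hφ.isTest_pderiv k) hψ i, key (hφ.isTest_pderiv i) hψ k]
  simp_rw [hsymm]

lemma IsTest.setIntegral_mul {φ : Plane → ℝ} (hφ : IsTest Ω φ) (g : Plane → ℝ) :
    ∫ x in Ω, φ x * g x = ∫ x, φ x * g x := by
  refine setIntegral_eq_integral_of_forall_compl_eq_zero fun x hx => ?_
  rw [image_eq_zero_of_notMem_tsupport fun h => hx (hφ.2.2 h), zero_mul]

/-- The identity behind Korn's inequality: `∫ ∂_k u ∂_i v = ∫ ∂_i u ∂_k v` on `H¹₀(Ω)`. -/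
lemma H10.inner_grad_comm (w w' : H10 Ω) (i k : Fin 2) :
    inner ℝ (w.1.2 k) (w'.1.2 i) = inner ℝ (w.1.2 i) (w'.1.2 k) := by
  refine H10.closed_induction
    (P := fun w => inner ℝ (w.2 k) (w'.1.2 i) = inner ℝ (w.2 i) (w'.1.2 k))
    (isClosed_eq (by fun_prop) (by fun_prop)) ?_ w
  rintro w ⟨φ, hφ, -, hw⟩
  refine H10.closed_induction
    (P := fun w' => inner ℝ (w.2 k) (w'.2 i) = inner ℝ (w.2 i) (w'.2 k))
    (isClosed_eq (by fun_prop) (by fun_prop)) ?_ w'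
  rintro w' ⟨ψ, hψ, -, hw'⟩
  have h : ∀ i k, inner ℝ (w.2 k) (w'.2 i) = ∫ x, pderiv k φ x * pderiv i ψ x := by
    intro i k
    rw [← ip_eq_inner, ip, ← (hφ.isTest_pderiv k).setIntegral_mul]
    refine integral_congr_ae ?_
    filter_upwards [hw k, hw' i] with x h1 h2
    rw [h1, h2]
  rw [h, h, integral_pderiv_mul_pderiv_comm hφ hψ]

lemma norm_fderiv_le_sum_pderiv (φ : Plane → ℝ) (x : Plane) :
    ‖fderiv ℝ φ x‖ ≤ ∑ k, ‖pderiv k φ x‖ := by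
  refine ContinuousLinearMap.opNorm_le_bound _ (by positivity) fun v => ?_
  have hv : v = ∑ k, v k • (EuclideanSpace.single k (1 : ℝ) : Plane) := by
    ext i; fin_cases i <;> simp
  conv_lhs => rw [hv]
  rw [map_sum, Finset.sum_mul]
  refine (norm_sum_le _ _).trans (Finset.sum_le_sum fun k _ => ?_)
  rw [map_smul, norm_smul, mul_comm]
  exact mul_le_mul_of_nonneg_left (PiLp.norm_apply_le v k) (norm_nonneg _)

lemma IsTest.eLpNorm_restrict {φ : Plane → ℝ} (hφ : IsTest Ω φ) (p : ENNReal) :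
    eLpNorm φ p ((volume : Measure Plane).restrict Ω) = eLpNorm φ p volume :=
  eLpNorm_restrict_eq_of_support_subset ((subset_tsupport φ).trans hφ.2.2)

/-- The Gagliardo-Nirenberg-Sobolev inequality `‖φ‖_{L²} ≤ K ∑ ‖∂_k φ‖_{L¹}` for test functions in the
plane, with a constant independent of the open set. -/
lemma exists_eLpNorm_two_le : ∃ K : NNReal, ∀ (Ω : Set Plane) (φ : Plane → ℝ), IsTest Ω φ →
    eLpNorm φ 2 ((volume : Measure Plane).restrict Ω)
      ≤ K * ∑ k, eLpNorm (pderiv k φ) 1 ((volume : Measure Plane).restrict Ω) := by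
  refine ⟨eLpNormLESNormFDerivOneConst (volume : Measure Plane) (2 : NNReal), fun Ω φ hφ => ?_⟩
  have h := eLpNorm_le_eLpNorm_fderiv_one (volume : Measure Plane) (u := φ)
    (hφ.1.of_le (by simp)) hφ.2.1 (p := 2)
    (by simp [NNReal.holderConjugate_iff]; norm_num)
  rw [hφ.eLpNorm_restrict]
  refine h.trans ?_
  simp_rw [(hφ.isTest_pderiv _).eLpNorm_restrict]
  gcongr
  refine (eLpNorm_mono_real (g := fun x => ∑ k, ‖pderiv k φ x‖)
    (fun x => norm_fderiv_le_sum_pderiv φ x)).trans ?_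
  have := eLpNorm_sum_le (μ := (volume : Measure Plane)) (p := 1) (s := Finset.univ)
    (f := fun (k : Fin 2) x => ‖pderiv k φ x‖)
    (fun k _ => ((hφ.isTest_pderiv k).1.continuous.norm.aestronglyMeasurable)) le_rfl
  simp_rw [eLpNorm_norm] at this
  refine le_trans (le_of_eq ?_) this
  congr 1

/-! ### The Poincaré and Ladyzhenskaya inequalities -/

lemma enorm_eq_eLpNorm_of_ae {u : L2 Ω} {φ : Plane → ℝ}
    (h : ∀ᵐ x ∂((volume : Measure Plane).restrict Ω), u x = φ x) :
    ‖u‖ₑ = eLpNorm φ 2 ((volume : Measure Plane).restrict Ω) := by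
  rw [Lp.enorm_def]; exact eLpNorm_congr_ae h

/-- The Poincaré inequality. On a bounded set the `L¹` norm of the gradient is at most a multiple of
its `L²` norm. -/
lemma H10.exists_poincare (hbdd : Bornology.IsBounded Ω) :
    ∃ C : NNReal, ∀ w : H10 Ω, ‖w.1.1‖ ≤ C * ∑ k, ‖w.1.2 k‖ := by
  obtain ⟨K, hK⟩ := exists_eLpNorm_two_le
  set μ := (volume : Measure Plane).restrict Ω with hμ
  have hfin : μ Set.univ ≠ ⊤ := by
    rw [hμ, Measure.restrict_apply_univ]; exact hbdd.measure_lt_top.ne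
  set D : NNReal := ((μ Set.univ) ^ ((1 : ℝ) / 2)).toNNReal with hD
  have hDe : (D : ENNReal) = (μ Set.univ) ^ ((1 : ℝ) / 2) :=
    ENNReal.coe_toNNReal (ENNReal.rpow_ne_top_of_nonneg (by norm_num) hfin)
  refine ⟨K * D, H10.closed_induction
    (P := fun w => ‖w.1‖ ≤ (K * D : NNReal) * ∑ k, ‖w.2 k‖)
    (isClosed_le (by fun_prop) (by fun_prop)) ?_⟩
  rintro w ⟨φ, hφ, h1, h2⟩
  have h : ‖w.1‖ₑ ≤ (K * D : NNReal) * ∑ k, ‖w.2 k‖ₑ := by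
    rw [enorm_eq_eLpNorm_of_ae h1]
    refine (hK Ω φ hφ).trans ?_
    rw [ENNReal.coe_mul, mul_assoc]
    gcongr (K : ENNReal) * ?_
    rw [Finset.mul_sum]
    gcongr with k
    rw [enorm_eq_eLpNorm_of_ae (h2 k), hDe, mul_comm]
    refine (eLpNorm_le_eLpNorm_mul_rpow_measure_univ (p := 1) (q := 2) (by norm_num)
      (hφ.isTest_pderiv k).1.continuous.aestronglyMeasurable).trans (le_of_eq ?_)
    norm_num [hμ]
  simp only [enorm_eq_nnnorm] at h
  have h' : ‖w.1‖₊ ≤ (K * D : NNReal) * ∑ k, ‖w.2 k‖₊ := by exact_mod_cast h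
  exact_mod_cast h'

lemma IsTest.eLpNorm_pderiv_sq_le {φ : Plane → ℝ} (hφ : IsTest Ω φ) (k : Fin 2) :
    eLpNorm (pderiv k (fun x => φ x * φ x)) 1 ((volume : Measure Plane).restrict Ω)
      ≤ 2 * (eLpNorm φ 2 ((volume : Measure Plane).restrict Ω)
        * eLpNorm (pderiv k φ) 2 ((volume : Measure Plane).restrict Ω)) := by
  have hd : pderiv k (fun x => φ x * φ x) = fun x => 2 * φ x * pderiv k φ x := by
    ext x
    rw [pderiv_mul hφ.differentiable hφ.differentiable]
    ring
  rw [hd, ← mul_assoc]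
  exact eLpNorm_le_eLpNorm_mul_eLpNorm'_of_norm (p := 2) (q := 2)
    hφ.1.continuous.aestronglyMeasurable (hφ.isTest_pderiv k).1.continuous.aestronglyMeasurable
    (fun a b : ℝ => 2 * a * b) 2 (ae_of_all _ fun x => by simp)

/-- Ladyzhenskaya's inequality `‖u‖²_{L⁴} ≤ K ‖u‖ ∑ ‖∂_k u‖`, written for the `L²` norm of `u²`. Its
validity in the limit is Fatou's lemma along an almost everywhere convergent subsequence. -/
lemma H10.exists_eLpNorm_sq_le :
    ∃ K : NNReal, ∀ (Ω : Set Plane) (w : H10 Ω),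
      eLpNorm (fun x => w.1.1 x * w.1.1 x) 2 ((volume : Measure Plane).restrict Ω)
        ≤ (K * ‖w.1.1‖₊ * ∑ k, ‖w.1.2 k‖₊ : NNReal) := by
  obtain ⟨K, hK⟩ := exists_eLpNorm_two_le
  refine ⟨2 * K, fun Ω => ?_⟩
  set μ := (volume : Measure Plane).restrict Ω with hμ
  refine H10.closed_induction (P := fun w => eLpNorm (fun x => w.1 x * w.1 x) 2 μ
    ≤ (2 * K * ‖w.1‖₊ * ∑ k, ‖w.2 k‖₊ : NNReal)) ?_ ?_
  · refine IsSeqClosed.isClosed fun w w₀ hw hlim => ?_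
    have h1 : Tendsto (fun n => (w n).1) atTop (𝓝 w₀.1) :=
      (continuous_fst.tendsto w₀).comp hlim
    obtain ⟨ns, hns, hae⟩ := (tendstoInMeasure_of_tendsto_Lp h1).exists_seq_tendsto_ae
    refine (Lp.eLpNorm_lim_le_liminf_eLpNorm
      (f := fun n x => (w (ns n)).1 x * (w (ns n)).1 x)
      (fun n => (Lp.aestronglyMeasurable _).mul (Lp.aestronglyMeasurable _)) _
      (hae.mono fun x hx => hx.mul hx)).trans ?_
    have hc : Continuous fun w : L2 Ω × (Fin 2 → L2 Ω) =>
        ((2 * K * ‖w.1‖₊ * ∑ k, ‖w.2 k‖₊ : NNReal) : ENNReal) :=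
      ENNReal.continuous_coe.comp (by fun_prop)
    rw [← ((hc.tendsto w₀).comp (hlim.comp hns.tendsto_atTop)).liminf_eq]
    exact liminf_le_liminf (Eventually.of_forall fun n => hw (ns n))
  · rintro w ⟨φ, hφ, h1, h2⟩
    have e : eLpNorm (fun x => w.1 x * w.1 x) 2 μ = eLpNorm (fun x => φ x * φ x) 2 μ :=
      eLpNorm_congr_ae (h1.mono fun x hx => by simp only [hx])
    rw [e]
    refine (hK Ω _ (hφ.mul hφ)).trans ?_
    push_cast
    rw [← enorm_eq_nnnorm, mul_comm (2 : ENNReal), mul_assoc, mul_assoc]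
    gcongr (K : ENNReal) * ?_
    rw [Finset.mul_sum, Finset.mul_sum]
    gcongr with k
    rw [← enorm_eq_nnnorm, enorm_eq_eLpNorm_of_ae h1, enorm_eq_eLpNorm_of_ae (h2 k)]
    exact hφ.eLpNorm_pderiv_sq_le k

/-- Hölder's inequality with exponents `4, 2, 4` combined with Ladyzhenskaya's inequality. The product
`u v` is handled as an element of `L²`, with `‖u v‖² = ⟨u², v²⟩`. -/
lemma H10.exists_trilinear_le :
    ∃ K : ℝ, 0 ≤ K ∧ ∀ (Ω : Set Plane) (u v : H10 Ω) (p : L2 Ω),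
      Integrable (fun x => u.1.1 x * p x * v.1.1 x) ((volume : Measure Plane).restrict Ω) ∧
      |∫ x in Ω, u.1.1 x * p x * v.1.1 x| ≤ K * √(‖u.1.1‖ * ∑ k, ‖u.1.2 k‖) * ‖p‖ *
        √(‖v.1.1‖ * ∑ k, ‖v.1.2 k‖) := by
  obtain ⟨K, hK⟩ := H10.exists_eLpNorm_sq_le
  refine ⟨K, K.2, fun Ω u v p => ?_⟩
  set μ := (volume : Measure Plane).restrict Ω with hμ
  have hsq : ∀ w : H10 Ω, MemLp (fun x => w.1.1 x * w.1.1 x) 2 μ := fun w =>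
    ⟨(Lp.aestronglyMeasurable _).mul (Lp.aestronglyMeasurable _),
      (hK Ω w).trans_lt ENNReal.coe_lt_top⟩
  have hsqn : ∀ w : H10 Ω, ‖(hsq w).toLp‖ ≤ K * (‖w.1.1‖ * ∑ k, ‖w.1.2 k‖) := by
    intro w
    rw [Lp.norm_toLp]
    refine (ENNReal.toReal_mono ENNReal.coe_ne_top (hK Ω w)).trans (le_of_eq ?_)
    rw [ENNReal.coe_toReal]
    push_cast
    simp only [mul_assoc]
  -- `2 |u v| ≤ u² + v²`
  have huv : MemLp (fun x => u.1.1 x * v.1.1 x) 2 μ := by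
    refine ((hsq u).add (hsq v)).mono'
      ((Lp.aestronglyMeasurable _).mul (Lp.aestronglyMeasurable _)) (ae_of_all _ fun x => ?_)
    rw [Real.norm_eq_abs, abs_le, Pi.add_apply]
    constructor <;> nlinarith [sq_nonneg (u.1.1 x + v.1.1 x), sq_nonneg (u.1.1 x - v.1.1 x),
      sq_nonneg (u.1.1 x), sq_nonneg (v.1.1 x)]
  have hn : ‖huv.toLp‖ ≤ K * √(‖u.1.1‖ * ∑ k, ‖u.1.2 k‖) * √(‖v.1.1‖ * ∑ k, ‖v.1.2 k‖) := by
    refine abs_le_of_sq_le_sq' ?_ (by positivity) |>.2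
    have e : ‖huv.toLp‖ ^ 2 = inner ℝ (hsq u).toLp (hsq v).toLp := by
      rw [← real_inner_self_eq_norm_sq, L2.inner_def, L2.inner_def]
      refine integral_congr_ae ?_
      filter_upwards [huv.coeFn_toLp, (hsq u).coeFn_toLp, (hsq v).coeFn_toLp] with x h1 h2 h3
      simp only [h1, h2, h3, inner]
      simp
      ring
    rw [e, mul_pow, mul_pow, Real.sq_sqrt (by positivity), Real.sq_sqrt (by positivity)]
    calc inner ℝ (hsq u).toLp (hsq v).toLp ≤ ‖(hsq u).toLp‖ * ‖(hsq v).toLp‖ :=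
          real_inner_le_norm _ _
      _ ≤ (K * (‖u.1.1‖ * ∑ k, ‖u.1.2 k‖)) * (K * (‖v.1.1‖ * ∑ k, ‖v.1.2 k‖)) :=
          mul_le_mul (hsqn u) (hsqn v) (norm_nonneg _) (by positivity)
      _ = _ := by ring
  have hr : (fun x => u.1.1 x * p x * v.1.1 x) = fun x => p x * (u.1.1 x * v.1.1 x) := by
    ext x; ring
  rw [hr]
  refine ⟨integrable_mul p huv, ?_⟩
  have e : ∫ x in Ω, p x * (u.1.1 x * v.1.1 x) = inner ℝ p huv.toLp := by
    rw [← ip_eq_inner]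
    refine integral_congr_ae ?_
    filter_upwards [huv.coeFn_toLp] with x h1
    rw [h1]
  rw [e]
  calc |inner ℝ p huv.toLp| ≤ ‖p‖ * ‖huv.toLp‖ := abs_real_inner_le_norm _ _
    _ ≤ ‖p‖ * (K * √(‖u.1.1‖ * ∑ k, ‖u.1.2 k‖) * √(‖v.1.1‖ * ∑ k, ‖v.1.2 k‖)) := by gcongr
    _ = _ := by ring

/-! ### Norms of velocity fields -/

lemma ip_self (p : L2 Ω) : ip p p = ‖p‖ ^ 2 := by
  rw [ip_eq_inner, real_inner_self_eq_norm_sq]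

lemma vnorm_nonneg (u : VecL2 Ω) : 0 ≤ vnorm u := Real.sqrt_nonneg _

lemma gradNorm_nonneg (u : Vel Ω) : 0 ≤ gradNorm u := Real.sqrt_nonneg _

lemma vnorm_sq (u : VecL2 Ω) : vnorm u ^ 2 = ∑ i, ‖u i‖ ^ 2 := by
  simp only [vnorm, vip, ip_self]
  exact Real.sq_sqrt (by positivity)

lemma gradNorm_sq (u : Vel Ω) : gradNorm u ^ 2 = ∑ i, ∑ k, ‖u.part i k‖ ^ 2 := by
  simp only [gradNorm, ip_self]
  exact Real.sq_sqrt (by positivity)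

lemma vip_self (u : VecL2 Ω) : vip u u = vnorm u ^ 2 := by
  simp only [vnorm_sq, vip, ip_self]

lemma norm_apply_le_vnorm (u : VecL2 Ω) (i : Fin 2) : ‖u i‖ ≤ vnorm u := by
  refine abs_le_of_sq_le_sq' ?_ (vnorm_nonneg u) |>.2
  rw [vnorm_sq]
  exact Finset.single_le_sum (f := fun i => ‖u i‖ ^ 2) (fun _ _ => by positivity)
    (Finset.mem_univ i)

lemma norm_part_le_gradNorm (u : Vel Ω) (i k : Fin 2) : ‖u.part i k‖ ≤ gradNorm u := by
  refine abs_le_of_sq_le_sq' ?_ (gradNorm_nonneg u) |>.2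
  rw [gradNorm_sq]
  exact (Finset.single_le_sum (f := fun k => ‖u.part i k‖ ^ 2) (fun _ _ => by positivity)
    (Finset.mem_univ k)).trans
    (Finset.single_le_sum (f := fun i => ∑ k, ‖u.part i k‖ ^ 2) (fun _ _ => by positivity)
      (Finset.mem_univ i))

lemma vip_le (u v : VecL2 Ω) : vip u v ≤ vnorm u * vnorm v := by
  have h : ∀ i, ip (u i) (v i) ≤ ‖u i‖ * ‖v i‖ := fun i => by
    rw [ip_eq_inner]; exact real_inner_le_norm _ _
  refine (Finset.sum_le_sum fun i _ => h i).trans ?_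
  refine (Real.sum_mul_le_sqrt_mul_sqrt _ _ _).trans (le_of_eq ?_)
  rw [← vnorm_sq, ← vnorm_sq, Real.sqrt_sq (vnorm_nonneg u), Real.sqrt_sq (vnorm_nonneg v)]

lemma sum_norm_part_le (u : Vel Ω) (i : Fin 2) : ∑ k, ‖u.part i k‖ ≤ 2 * gradNorm u := by
  rw [Fin.sum_univ_two]
  linarith [norm_part_le_gradNorm u i 0, norm_part_le_gradNorm u i 1]

/-! ### Inequalities for velocity fields -/

/-- The Poincaré inequality for velocity fields. The constant is written as a square because
`√(‖u‖ ‖∇u‖) ≤ C ‖∇u‖` is the form in which it enters the convective terms. -/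
lemma exists_poincare (hbdd : Bornology.IsBounded Ω) :
    ∃ C : ℝ, 0 ≤ C ∧ ∀ u : Vel Ω, vnorm u.val ≤ C ^ 2 * gradNorm u := by
  obtain ⟨C, hC⟩ := H10.exists_poincare hbdd
  refine ⟨√(4 * C), Real.sqrt_nonneg _, fun u => ?_⟩
  rw [Real.sq_sqrt (by positivity)]
  have h : ∀ i, ‖u.val i‖ ≤ C * (2 * gradNorm u) := fun i =>
    (hC (u i)).trans (mul_le_mul_of_nonneg_left (sum_norm_part_le u i) C.2)
  have hG := gradNorm_nonneg u
  refine abs_le_of_sq_le_sq' ?_ (by positivity) |>.2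
  rw [vnorm_sq, Fin.sum_univ_two]
  have h0 := pow_le_pow_left₀ (norm_nonneg _) (h 0) 2
  have h1 := pow_le_pow_left₀ (norm_nonneg _) (h 1) 2
  nlinarith [sq_nonneg ((C : ℝ) * gradNorm u)]

/-- Korn's inequality: `2 ‖𝔻(u)‖² = ‖∇u‖² + ‖∇ · u‖²` on `H¹₀(Ω)²`. -/
lemma half_gradNorm_sq_le_deform (u : Vel Ω) :
    gradNorm u ^ 2 / 2 ≤ ∑ i, ∑ k, ip (u.deform i k) (u.deform i k) := by
  have hcomm : inner ℝ (u.part 0 1) (u.part 1 0) = inner ℝ (u.part 0 0) (u.part 1 1) :=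
    H10.inner_grad_comm (u 0) (u 1) 0 1
  have hdiv := real_inner_self_nonneg (x := u.part 0 0 + u.part 1 1)
  simp only [gradNorm_sq, ← real_inner_self_eq_norm_sq, ip_eq_inner, Vel.deform,
    Fin.sum_univ_two, inner_add_left, inner_add_right, inner_smul_left, inner_smul_right] at hdiv ⊢
  rw [real_inner_comm (u.part 0 1) (u.part 1 0)]
  rw [real_inner_comm (u.part 0 0) (u.part 1 1)] at hdiv
  simp only [conj_trivial]
  nlinarith [real_inner_self_nonneg (x := u.part 0 0), real_inner_self_nonneg (x := u.part 1 1)]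

lemma bForm_integrable (u w v : Vel Ω) (i k : Fin 2) :
    Integrable (fun x => u.val k x * w.part i k x * v.val i x)
      ((volume : Measure Plane).restrict Ω) := by
  obtain ⟨K, -, hK⟩ := H10.exists_trilinear_le
  exact (hK Ω (u k) (v i) (w.part i k)).1

/-- The convective form is bounded with the geometric means `(‖u‖ ‖∇u‖)^{1/2}` of its first and last
arguments, uniformly in the domain. -/
lemma exists_bForm_le : ∃ L : ℝ, 0 ≤ L ∧ ∀ (Ω : Set Plane) (u w v : Vel Ω),
    |bForm u w v| ≤ L * √(vnorm u.val * gradNorm u) * gradNorm w *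
      √(vnorm v.val * gradNorm v) := by
  obtain ⟨K, hK0, hK⟩ := H10.exists_trilinear_le
  refine ⟨8 * K, by positivity, fun Ω u w v => ?_⟩
  have hs : ∀ (u : Vel Ω) (i : Fin 2), √(‖(u i).1.1‖ * ∑ k, ‖(u i).1.2 k‖)
      ≤ √2 * √(vnorm u.val * gradNorm u) := by
    intro u i
    rw [← Real.sqrt_mul zero_le_two]
    refine Real.sqrt_le_sqrt ?_
    calc ‖(u i).1.1‖ * ∑ k, ‖(u i).1.2 k‖ ≤ vnorm u.val * (2 * gradNorm u) :=
          mul_le_mul (norm_apply_le_vnorm u.val i) (sum_norm_part_le u i) (by positivity)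
            (vnorm_nonneg _)
      _ = _ := by ring
  have hG := gradNorm_nonneg w
  have h : ∀ i k, |∫ x in Ω, u.val k x * w.part i k x * v.val i x|
      ≤ 2 * (K * √(vnorm u.val * gradNorm u) * gradNorm w * √(vnorm v.val * gradNorm v)) := by
    intro i k
    refine ((hK Ω (u k) (v i) (w.part i k)).2).trans ?_
    calc _ ≤ K * (√2 * √(vnorm u.val * gradNorm u)) * gradNorm w *
          (√2 * √(vnorm v.val * gradNorm v)) := by
          gcongr
          · exact hs u k
          · exact norm_part_le_gradNorm w i k
          · exact hs v i
      _ = (√2 * √2) * (K * √(vnorm u.val * gradNorm u) * gradNorm w *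
          √(vnorm v.val * gradNorm v)) := by ring
      _ = _ := by rw [Real.mul_self_sqrt zero_le_two]
  refine (Finset.abs_sum_le_sum_abs _ _).trans ((Finset.sum_le_sum fun i _ =>
    (Finset.abs_sum_le_sum_abs _ _).trans (Finset.sum_le_sum fun k _ => h i k)).trans
      (le_of_eq ?_))
  simp only [Finset.sum_const, Finset.card_univ, Fintype.card_fin, nsmul_eq_mul]
  push_cast
  ring

/-! ### Bilinearity of the forms -/

lemma bForm_sub_left (u u' w v : Vel Ω) : bForm (u - u') w v = bForm u w v - bForm u' w v := by
  simp only [bForm, ← Finset.sum_sub_distrib]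
  refine Finset.sum_congr rfl fun i _ => Finset.sum_congr rfl fun k _ => ?_
  rw [← integral_sub (bForm_integrable ..) (bForm_integrable ..)]
  refine integral_congr_ae ?_
  filter_upwards [Lp.coeFn_sub (u.val k) (u'.val k)] with x hx
  have : (u - u').val k x = u.val k x - u'.val k x := hx
  rw [this]; ring

lemma bForm_sub_middle (u w w' v : Vel Ω) :
    bForm u (w - w') v = bForm u w v - bForm u w' v := by
  simp only [bForm, ← Finset.sum_sub_distrib]
  refine Finset.sum_congr rfl fun i _ => Finset.sum_congr rfl fun k _ => ?_
  rw [← integral_sub (bForm_integrable ..) (bForm_integrable ..)]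
  refine integral_congr_ae ?_
  filter_upwards [Lp.coeFn_sub (w.part i k) (w'.part i k)] with x hx
  have : (w - w').part i k x = w.part i k x - w'.part i k x := hx
  rw [this]; ring

lemma bForm_sub_right (u w v v' : Vel Ω) : bForm u w (v - v') = bForm u w v - bForm u w v' := by
  simp only [bForm, ← Finset.sum_sub_distrib]
  refine Finset.sum_congr rfl fun i _ => Finset.sum_congr rfl fun k _ => ?_
  rw [← integral_sub (bForm_integrable ..) (bForm_integrable ..)]
  refine integral_congr_ae ?_
  filter_upwards [Lp.coeFn_sub (v.val i) (v'.val i)] with x hx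
  have : (v - v').val i x = v.val i x - v'.val i x := hx
  rw [this]; ring

lemma vip_sub_left (u u' v : VecL2 Ω) : vip (u - u') v = vip u v - vip u' v := by
  simp only [vip, ip_eq_inner, Pi.sub_apply, inner_sub_left, Finset.sum_sub_distrib]

lemma vip_neg_left (u v : VecL2 Ω) : vip (-u) v = -vip u v := by
  simp only [vip, ip_eq_inner, Pi.neg_apply, inner_neg_left, Finset.sum_neg_distrib]

lemma vip_smul_left (c : ℝ) (u v : VecL2 Ω) : vip (c • u) v = c * vip u v := by
  simp only [vip, ip_eq_inner, Pi.smul_apply, real_inner_smul_left, Finset.mul_sum]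

lemma Vel.deform_sub (u v : Vel Ω) (i k : Fin 2) :
    (u - v).deform i k = u.deform i k - v.deform i k := by
  have h : ∀ i k, (u - v).part i k = u.part i k - v.part i k := fun _ _ => rfl
  rw [Vel.deform, Vel.deform, Vel.deform, h, h, ← smul_sub]
  congr 1
  abel

lemma aForm_sub_left (ν : ℝ) (u u' v : Vel Ω) :
    aForm ν (u - u') v = aForm ν u v - aForm ν u' v := by
  simp only [aForm, ip_eq_inner, Vel.deform_sub, inner_sub_left, Finset.sum_sub_distrib]
  ring

lemma le_aForm_self {ν : ℝ} (hν : 0 ≤ ν) (u : Vel Ω) : ν / 2 * gradNorm u ^ 2 ≤ aForm ν u u := by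
  have := mul_le_mul_of_nonneg_left (half_gradNorm_sq_le_deform u) hν
  rw [aForm]
  linarith

lemma Vel.val_sub (u v : Vel Ω) : (u - v).val = u.val - v.val := rfl

/-! ### The weight matrix and the data matrices -/

lemma h1ip_add_left (u u' v : Vel Ω) : h1ip (u + u') v = h1ip u v + h1ip u' v := by
  have h1 : ∀ i, (u + u').val i = u.val i + u'.val i := fun _ => rfl
  have h2 : ∀ i k, (u + u').part i k = u.part i k + u'.part i k := fun _ _ => rfl
  simp only [h1ip, vip, ip_eq_inner, h1, h2, inner_add_left, Finset.sum_add_distrib]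
  ring

lemma h1ip_smul_left (c : ℝ) (u v : Vel Ω) : h1ip (c • u) v = c * h1ip u v := by
  have h1 : ∀ i, (c • u).val i = c • u.val i := fun _ => rfl
  have h2 : ∀ i k, (c • u).part i k = c • u.part i k := fun _ _ => rfl
  simp only [h1ip, vip, ip_eq_inner, h1, h2, real_inner_smul_left, mul_add, Finset.mul_sum]

lemma h1ip_comm (u v : Vel Ω) : h1ip u v = h1ip v u := by
  simp only [h1ip, vip, ip_eq_inner, real_inner_comm]

/-- The `H¹` inner product of velocity fields as a bilinear form. -/
noncomputable def h1Bilin (Ω : Set Plane) : Vel Ω →ₗ[ℝ] Vel Ω →ₗ[ℝ] ℝ :=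
  LinearMap.mk₂ ℝ h1ip h1ip_add_left h1ip_smul_left
    (fun u v w => by rw [h1ip_comm, h1ip_add_left, h1ip_comm v, h1ip_comm w])
    (fun c u v => by rw [h1ip_comm, h1ip_smul_left, h1ip_comm v, smul_eq_mul])

lemma h1ip_self (u : Vel Ω) : h1ip u u = vnorm u.val ^ 2 + gradNorm u ^ 2 := by
  rw [h1ip, vip_self, gradNorm_sq]
  simp only [ip_self]

lemma StablePair.repr_dotProduct_weight (S : StablePair Ω) (v : S.Vh) :
    (S.φ.repr v : Fin S.m → ℝ) ⬝ᵥ S.weight.mulVec (S.φ.repr v) = h1ip v.1 v.1 := by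
  have hv : v.1 = ∑ i, S.φ.repr v i • (S.φ i).1 := by
    have h := congrArg S.Vh.subtype (S.φ.sum_repr v)
    rw [map_sum] at h
    exact h.symm
  have h : h1ip v.1 v.1 = h1Bilin Ω v.1 v.1 := rfl
  rw [h]
  conv_rhs => rw [hv]
  simp only [map_sum, map_smul, LinearMap.sum_apply, LinearMap.smul_apply, smul_eq_mul,
    dotProduct, Matrix.mulVec, StablePair.weight, Finset.mul_sum]
  refine Finset.sum_congr rfl fun i _ => Finset.sum_congr rfl fun k _ => ?_
  have : h1Bilin Ω (S.φ k).1 (S.φ i).1 = h1ip (S.φ k).1 (S.φ i).1 := rfl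
  rw [this]
  ring

/-- The time-discrete `L²(0, T; H¹₀)` error of the data is at most the Hilbert-Schmidt distance of the
data matrices. -/
lemma StablePair.sum_gradNorm_sq_le_hsNorm_sq (S : StablePair Ω) {τ : ℝ} (hτ : 0 ≤ τ) (n : ℕ)
    (u w : ℕ → S.Vh) :
    ∑ j ∈ Finset.range n, τ * gradNorm ((u (j + 1)).1 - (w (j + 1)).1) ^ 2
      ≤ hsNorm S.weight (S.dataMatrix τ n u - S.dataMatrix τ n w) ^ 2 := by
  rw [hsNorm, Real.sq_sqrt (by positivity), ← Fin.sum_univ_eq_sum_range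
    (fun j => τ * gradNorm ((u (j + 1)).1 - (w (j + 1)).1) ^ 2)]
  refine Finset.sum_le_sum fun j _ => ?_
  set e : S.Vh := u (j + 1) - w (j + 1) with he
  have hcol : (S.dataMatrix τ n u - S.dataMatrix τ n w).mulVec (Pi.single j 1)
      = √τ • (S.φ.repr e : Fin S.m → ℝ) := by
    ext i
    have hi : S.φ.repr e i = S.φ.repr (u (j + 1)) i - S.φ.repr (w (j + 1)) i := by
      have h : S.φ.repr (e + w (j + 1)) i = S.φ.repr e i + S.φ.repr (w (j + 1)) i := by
        rw [map_add]; rfl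
      have hsum : e + w (j + 1) = u (j + 1) :=
        Subtype.ext (sub_add_cancel (u (j + 1)).1 (w (j + 1)).1)
      rw [hsum] at h
      linarith
    simp only [Matrix.mulVec_single_one, Matrix.col_apply, Matrix.sub_apply,
      StablePair.dataMatrix, Pi.smul_apply, smul_eq_mul, hi, mul_sub]
  have hq : (√τ • (S.φ.repr e : Fin S.m → ℝ)) ⬝ᵥ
      S.weight.mulVec (√τ • (S.φ.repr e : Fin S.m → ℝ)) = τ * h1ip e.1 e.1 := by
    rw [Matrix.mulVec_smul, dotProduct_smul, smul_dotProduct, S.repr_dotProduct_weight,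
      smul_eq_mul, smul_eq_mul, ← mul_assoc, Real.mul_self_sqrt hτ]
  rw [wnorm, hcol, hq, h1ip_self, Real.sq_sqrt (by positivity)]
  have : (u (j + 1)).1 - (w (j + 1)).1 = e.1 := rfl
  rw [this]
  nlinarith [mul_nonneg hτ (sq_nonneg (vnorm e.1.val))]

/-! ### Elementary inequalities -/

/-- Young's inequality with a parameter. -/
lemma mul_le_mul_sq_add_mul_sq {c : ℝ} (hc : 0 < c) (a b : ℝ) :
    a * b ≤ c * b ^ 2 + 1 / (4 * c) * a ^ 2 := by
  have h : c * b ^ 2 + 1 / (4 * c) * a ^ 2 - a * b = c * (b - a / (2 * c)) ^ 2 := by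
    field_simp; ring
  have := mul_nonneg hc.le (sq_nonneg (b - a / (2 * c)))
  linarith

lemma one_le_exp_mul_one_sub {x : ℝ} (h0 : 0 ≤ x) (h1 : x ≤ 1 / 2) :
    1 ≤ Real.exp (2 * x) * (1 - x) := by
  have := Real.add_one_le_exp (2 * x)
  nlinarith

/-- A discrete backward Gronwall inequality. The smallness of `x` gives `1 / (1 - x) ≤ exp (2 * x)`. -/
lemma discrete_gronwall_backward {a g : ℕ → ℝ} {x c : ℝ} {n : ℕ} (hx0 : 0 ≤ x)
    (hx : x ≤ 1 / 2) (hc : 0 ≤ c) (ha : ∀ j, 0 ≤ a j) (hg : ∀ j, 0 ≤ g j) (han : a n = 0)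
    (h : ∀ j < n, (1 - x) * a j ≤ a (j + 1) + c * g j) :
    a 0 ≤ Real.exp (2 * x * n) * (c * ∑ j ∈ Finset.range n, g j) := by
  set r := Real.exp (2 * x) with hr
  have hr1 : 1 ≤ r := Real.one_le_exp (by positivity)
  have hrx : 1 ≤ r * (1 - x) := one_le_exp_mul_one_sub hx0 hx
  have key : ∀ m ≤ n, a 0 ≤ r ^ m * (a m + c * ∑ j ∈ Finset.range m, g j) := by
    intro m
    induction m with
    | zero => simp
    | succ m ih =>
      intro hm
      refine (ih (by omega)).trans ?_
      rw [pow_succ, mul_assoc, Finset.sum_range_succ]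
      refine mul_le_mul_of_nonneg_left ?_ (by positivity)
      have hS : 0 ≤ c * ∑ j ∈ Finset.range m, g j :=
        mul_nonneg hc (Finset.sum_nonneg fun j _ => hg j)
      have h1 : a m ≤ r * (a (m + 1) + c * g m) :=
        calc a m = 1 * a m := (one_mul _).symm
          _ ≤ r * (1 - x) * a m := mul_le_mul_of_nonneg_right hrx (ha m)
          _ = r * ((1 - x) * a m) := by ring
          _ ≤ _ := mul_le_mul_of_nonneg_left (h m (by omega)) (by positivity)
      nlinarith
  have := key n le_rfl
  rwa [han, zero_add, hr, ← Real.exp_nat_mul, mul_comm (n : ℝ)] at this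

/-- The coefficient of `‖δ‖²` in the energy estimate, for a bound `B` of `‖∇u_r‖`, the constant `L` of
the convective form and the Poincaré constant `C ^ 2`. The summand `1` makes it positive. -/
noncomputable def growthConst (ν L C B : ℝ) : ℝ :=
  2 / ν * (L * B) ^ 2 + 4 / ν * (4 / ν * (L * C * B) ^ 2) ^ 2 + 1

/-- The coefficient of `‖∇e‖²` in the energy estimate, for a bound `B` of the gradient of the adjoint
velocity. -/
noncomputable def sourceConst (ν L C B : ℝ) : ℝ :=
  2 / ν * (2 * L * C ^ 2 * B + C ^ 4) ^ 2 + 1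

/-- Absorption of the right-hand side of the energy identity into half of the viscous term, with
`x = ‖∇δ‖`, `y = ‖δ‖` and `E = ‖∇e‖`. -/
lemma energy_absorb {ν L C B B' x y E : ℝ} (hν : 0 < ν) (hx : 0 ≤ x) (hy : 0 ≤ y) :
    L * √(y * x) * B * √(y * x) + L * (C * B) * x * √(y * x)
        + 2 * (L * C ^ 2 * B' * E * x) + C ^ 4 * E * x
      ≤ ν / 2 * x ^ 2 + growthConst ν L C B * y ^ 2 + sourceConst ν L C B' * E ^ 2 := by
  have hs : √(y * x) ^ 2 = y * x := Real.sq_sqrt (by positivity)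
  set s := √(y * x) with hsdef
  -- Three eighths of `ν * x ^ 2` are spent. The term with `√(y * x)` needs Young's inequality twice:
  -- `h2` leaves a multiple of `y * x`, which `h3` treats.
  have h1 := mul_le_mul_sq_add_mul_sq (c := ν / 8) (by positivity) (L * B * y) x
  have h2 := mul_le_mul_sq_add_mul_sq (c := ν / 16) (by positivity) (L * C * B * s) x
  have h3 := mul_le_mul_sq_add_mul_sq (c := ν / 16) (by positivity)
    (4 / ν * (L * C * B) ^ 2 * y) x
  have h4 := mul_le_mul_sq_add_mul_sq (c := ν / 8) (by positivity)
    ((2 * L * C ^ 2 * B' + C ^ 4) * E) x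
  have c8 : 1 / (4 * (ν / 8)) = 2 / ν := by field_simp; norm_num
  have c16 : 1 / (4 * (ν / 16)) = 4 / ν := by field_simp; norm_num
  rw [c8] at h1 h4
  rw [c16] at h2 h3
  have h2' : 4 / ν * (L * C * B * s) ^ 2 = 4 / ν * (L * C * B) ^ 2 * y * x := by
    rw [mul_pow, hs]; ring
  have e1 : L * s * B * s = L * B * y * x := by
    calc L * s * B * s = L * B * s ^ 2 := by ring
      _ = _ := by rw [hs]; ring
  rw [e1, growthConst, sourceConst]
  nlinarith [mul_nonneg hν.le (sq_nonneg x), sq_nonneg y, sq_nonneg E]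

/-! ### The error equation of the adjoint problem -/

lemma sqrt_vnorm_mul_gradNorm_le {C : ℝ} (hC : 0 ≤ C)
    (h : ∀ u : Vel Ω, vnorm u.val ≤ C ^ 2 * gradNorm u) (u : Vel Ω) :
    √(vnorm u.val * gradNorm u) ≤ C * gradNorm u := by
  refine Real.sqrt_le_iff.2 ⟨mul_nonneg hC (gradNorm_nonneg u), ?_⟩
  have := mul_le_mul_of_nonneg_right (h u) (gradNorm_nonneg u)
  nlinarith

/-- The equation satisfied by the difference of two adjoint velocities, tested with this
difference. The pressures drop out as both velocities are discretely divergence free. -/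
lemma IsAdjoint.difference_equation {S : StablePair Ω} {ν τ : ℝ} {n : ℕ} {û : ℕ → VecL2 Ω}
    {u ur us usr : ℕ → S.Vh} {ps psr : ℕ → L2 Ω} (h : IsAdjoint S ν τ n û u us ps)
    (hr : IsAdjoint S ν τ n û ur usr psr) {j : ℕ} (hj : j < n)
    {δ δ' e : Vel Ω} (hδ : δ = (us j).1 - (usr j).1)
    (hδ' : δ' = (us (j + 1)).1 - (usr (j + 1)).1)
    (he : e = (u (j + 1)).1 - (ur (j + 1)).1) :
    τ⁻¹ * (vip δ.val δ.val - vip δ'.val δ.val) + aForm ν δ δ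
      = -(bForm δ e (us j).1 + bForm δ (ur (j + 1)).1 δ + bForm e δ (us j).1
        + bForm (ur (j + 1)).1 δ δ + vip e.val δ.val) := by
  have h1 := h.step j hj (us j - usr j)
  have h2 := hr.step j hj (us j - usr j)
  have hv : (us j - usr j : S.Vh).1 = δ := hδ.symm
  rw [hv] at h1 h2
  have hdiv : ∀ q ∈ S.Qh, ip q δ.div = 0 := by
    intro q hq
    have e1 := h.divFree j hj q hq
    have e2 := hr.divFree j hj q hq
    have e3 : δ.div = (us j).1.div - (usr j).1.div := by
      simp only [Vel.div, ← Finset.sum_sub_distrib, hδ]; rfl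
    rw [e3, ip_eq_inner, inner_sub_right, ← ip_eq_inner, ← ip_eq_inner, e1, e2, sub_zero]
  rw [hdiv _ (h.pressure_mem j hj)] at h1
  rw [hdiv _ (hr.pressure_mem j hj)] at h2
  have v1 : vip δ.val δ.val = vip (us j).1.val δ.val - vip (usr j).1.val δ.val := by
    rw [← vip_sub_left, ← Vel.val_sub, ← hδ]
  have v2 : vip δ'.val δ.val = vip (us (j + 1)).1.val δ.val - vip (usr (j + 1)).1.val δ.val := by
    rw [hδ', Vel.val_sub, vip_sub_left]
  have v3 : vip e.val δ.val = vip (u (j + 1)).1.val δ.val - vip (ur (j + 1)).1.val δ.val := by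
    rw [he, Vel.val_sub, vip_sub_left]
  have v4 : aForm ν δ δ = aForm ν (us j).1 δ - aForm ν (usr j).1 δ := by
    rw [← aForm_sub_left, ← hδ]
  have b1 : bForm δ e (us j).1 = bForm δ (u (j + 1)).1 (us j).1
      - bForm δ (ur (j + 1)).1 (us j).1 := by
    rw [he, bForm_sub_middle]
  have b2 : bForm δ (ur (j + 1)).1 δ = bForm δ (ur (j + 1)).1 (us j).1
      - bForm δ (ur (j + 1)).1 (usr j).1 := by
    rw [← bForm_sub_right, ← hδ]
  have b3 : bForm e δ (us j).1 = bForm (u (j + 1)).1 δ (us j).1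
      - bForm (ur (j + 1)).1 δ (us j).1 := by
    rw [he, bForm_sub_left]
  have b4 : bForm (ur (j + 1)).1 δ δ = bForm (ur (j + 1)).1 δ (us j).1
      - bForm (ur (j + 1)).1 δ (usr j).1 := by
    rw [← bForm_sub_right, ← hδ]
  simp only [vip_neg_left, vip_smul_left, vip_sub_left] at h1 h2
  rw [v1, v2, v3, v4, b1, b2, b3, b4]
  linear_combination h1 - h2

/-- The energy inequality between two consecutive time levels. -/
lemma IsAdjoint.energy_step {S : StablePair Ω} {ν τ : ℝ} {n : ℕ} {û : ℕ → VecL2 Ω}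
    {u ur us usr : ℕ → S.Vh} {ps psr : ℕ → L2 Ω} (hν : 0 < ν) (hτ : 0 < τ)
    (h : IsAdjoint S ν τ n û u us ps) (hr : IsAdjoint S ν τ n û ur usr psr)
    {L C B B' : ℝ} (hL : 0 ≤ L) (hC : 0 ≤ C)
    (hb : ∀ u w v : Vel Ω, |bForm u w v| ≤ L * √(vnorm u.val * gradNorm u) * gradNorm w *
      √(vnorm v.val * gradNorm v))
    (hP : ∀ u : Vel Ω, vnorm u.val ≤ C ^ 2 * gradNorm u) {j : ℕ} (hj : j < n)
    (hB : gradNorm (ur (j + 1)).1 ≤ B) (hB' : gradNorm (us j).1 ≤ B') :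
    (1 - 2 * τ * growthConst ν L C B) * vnorm ((us j).1 - (usr j).1).val ^ 2
      ≤ vnorm ((us (j + 1)).1 - (usr (j + 1)).1).val ^ 2
        + 2 * sourceConst ν L C B' * (τ * gradNorm ((u (j + 1)).1 - (ur (j + 1)).1) ^ 2) := by
  have heq := h.difference_equation hr hj rfl rfl rfl
  set δ : Vel Ω := (us j).1 - (usr j).1
  set δ' : Vel Ω := (us (j + 1)).1 - (usr (j + 1)).1
  set e : Vel Ω := (u (j + 1)).1 - (ur (j + 1)).1
  set w : Vel Ω := (ur (j + 1)).1
  set z : Vel Ω := (us j).1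
  have hsq := sqrt_vnorm_mul_gradNorm_le hC hP
  have hδ0 := gradNorm_nonneg δ
  have he0 := gradNorm_nonneg e
  have hw0 := gradNorm_nonneg w
  have hz : √(vnorm z.val * gradNorm z) ≤ C * B' :=
    (hsq z).trans (mul_le_mul_of_nonneg_left hB' hC)
  have hw : √(vnorm w.val * gradNorm w) ≤ C * B :=
    (hsq w).trans (mul_le_mul_of_nonneg_left hB hC)
  have hB0 : 0 ≤ C * B' := (Real.sqrt_nonneg _).trans hz
  have t1 : -bForm δ e z ≤ L * C ^ 2 * B' * gradNorm e * gradNorm δ := by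
    refine (neg_le_abs _).trans ((hb δ e z).trans ?_)
    calc _ ≤ L * (C * gradNorm δ) * gradNorm e * (C * B') := by gcongr; exact hsq δ
      _ = _ := by ring
  have t2 : -bForm δ w δ ≤ L * √(vnorm δ.val * gradNorm δ) * B * √(vnorm δ.val * gradNorm δ) := by
    refine (neg_le_abs _).trans ((hb δ w δ).trans ?_)
    gcongr
  have t3 : -bForm e δ z ≤ L * C ^ 2 * B' * gradNorm e * gradNorm δ := by
    refine (neg_le_abs _).trans ((hb e δ z).trans ?_)
    calc _ ≤ L * (C * gradNorm e) * gradNorm δ * (C * B') := by gcongr; exact hsq e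
      _ = _ := by ring
  have t4 : -bForm w δ δ ≤ L * (C * B) * gradNorm δ * √(vnorm δ.val * gradNorm δ) := by
    refine (neg_le_abs _).trans ((hb w δ δ).trans ?_)
    gcongr
  have t5 : -vip e.val δ.val ≤ C ^ 4 * gradNorm e * gradNorm δ := by
    rw [← vip_neg_left]
    have hneg : vnorm (-e.val) = vnorm e.val := by
      simp only [vnorm, vip, ip_self, Pi.neg_apply, norm_neg]
    refine (vip_le _ _).trans ?_
    rw [hneg]
    calc _ ≤ (C ^ 2 * gradNorm e) * (C ^ 2 * gradNorm δ) :=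
          mul_le_mul (hP e) (hP δ) (vnorm_nonneg _) (by positivity)
      _ = _ := by ring
  have ha := le_aForm_self hν.le δ
  have habs := energy_absorb (L := L) (C := C) (B := B) (B' := B') (E := gradNorm e) hν hδ0
    (vnorm_nonneg δ.val)
  have hcs : vip δ'.val δ.val ≤ (vnorm δ'.val ^ 2 + vnorm δ.val ^ 2) / 2 :=
    (vip_le _ _).trans (by nlinarith [sq_nonneg (vnorm δ'.val - vnorm δ.val)])
  have hmain : τ⁻¹ * (vip δ.val δ.val - vip δ'.val δ.val)
      ≤ growthConst ν L C B * vnorm δ.val ^ 2 + sourceConst ν L C B' * gradNorm e ^ 2 := by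
    linarith
  rw [inv_mul_le_iff₀ hτ, vip_self] at hmain
  linarith

end NSCompress

theorem theorem3 (Ω : Set Plane) (hΩ : IsOpen Ω) (hbdd : Bornology.IsBounded Ω)
    (ν : ℝ) (hν : 0 < ν) :
    ∃ τ₀ C₃ C₄ : ℝ → ℝ, (∀ B : ℝ, 0 < τ₀ B ∧ 0 < C₃ B ∧ 0 < C₄ B) ∧
      ∀ (S : StablePair Ω) (n : ℕ) (τ T γ : ℝ), 0 < τ → T = n * τ →
      ∀ (f : ℕ → (Vel Ω →L[ℝ] ℝ)) (û : ℕ → VecL2 Ω) (u₀ : VecL2 Ω) (u : ℕ → S.Vh),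
        IsForward S ν τ n f u₀ u →
      ∀ (tolp tolsv ε : ℝ) (ur : ℕ → S.Vh), 0 < tolp → 0 < tolsv →
        IPOD S.weight tolp tolsv (S.dataMatrix τ n u) (S.dataMatrix τ n ur) →
        hsNorm S.weight (S.dataMatrix τ n u - S.dataMatrix τ n ur) ≤ ε →
      ∀ (us usr : ℕ → S.Vh) (ps psr : ℕ → L2 Ω),
        IsAdjoint S ν τ n û u us ps →
        IsAdjoint S ν τ n û ur usr psr →
      ∀ B B' : ℝ,
        (∀ j < n, gradNorm (ur (j + 1)).1 ≤ B) →
        (∀ j ≤ n, gradNorm (us j).1 ≤ B' ∧ gradNorm (usr j).1 ≤ B') →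
        τ ≤ τ₀ B →
        vnorm (gradJ γ u₀ (us 0).1 - gradJ γ u₀ (usr 0).1)
          ≤ √(C₄ B' * Real.exp (C₃ B * T)) * ε := by
  obtain ⟨C, hC, hP⟩ := exists_poincare hbdd
  obtain ⟨L, hL, hb⟩ := exists_bForm_le
  have hK : ∀ B, 0 < growthConst ν L C B := fun B => by rw [growthConst]; positivity
  have hK' : ∀ B, 0 < sourceConst ν L C B := fun B => by rw [sourceConst]; positivity
  refine ⟨fun B => 1 / (4 * growthConst ν L C B), fun B => 4 * growthConst ν L C B,
    fun B => 2 * sourceConst ν L C B, fun B => ⟨?_, ?_, ?_⟩, ?_⟩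
  · have := hK B; positivity
  · have := hK B; positivity
  · have := hK' B; positivity
  intro S n τ T γ hτ hT _ û u₀ u _ _ _ ε ur _ _ _ hε us usr ps psr hus husr B B' hB hB' hτ₀
  have hKB := hK B
  have hKB' := hK' B'
  have hx : 2 * τ * growthConst ν L C B ≤ 1 / 2 := by
    rw [le_div_iff₀ (by positivity)] at hτ₀
    linarith
  have hgr := discrete_gronwall_backward
    (a := fun j => vnorm ((us j).1 - (usr j).1).val ^ 2)
    (g := fun j => τ * gradNorm ((u (j + 1)).1 - (ur (j + 1)).1) ^ 2) (n := n)
    (by positivity) hx (c := 2 * sourceConst ν L C B') (by positivity)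
    (fun _ => by positivity) (fun _ => by positivity)
    (by
      have h0 : ((0 : S.Vh).1 - (0 : S.Vh).1).val = (0 : VecL2 Ω) := by
        rw [sub_self]; rfl
      simp only [hus.terminal, husr.terminal, h0]
      simp [vnorm_sq])
    (fun j hj => hus.energy_step hν hτ husr hL hC (hb Ω) hP hj (hB j hj) (hB' j hj.le).1)
  have hε0 : 0 ≤ ε := (Real.sqrt_nonneg _).trans hε
  have hsum := (S.sum_gradNorm_sq_le_hsNorm_sq hτ.le n u ur).trans
    (pow_le_pow_left₀ (Real.sqrt_nonneg _) hε 2)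
  have hgrad : vnorm (gradJ γ u₀ (us 0).1 - gradJ γ u₀ (usr 0).1) ^ 2
      = vnorm ((us 0).1 - (usr 0).1).val ^ 2 := by
    have : gradJ γ u₀ (us 0).1 - gradJ γ u₀ (usr 0).1 = -((us 0).1 - (usr 0).1).val := by
      rw [gradJ, gradJ, Vel.val_sub]; abel
    rw [this, vnorm_sq, vnorm_sq]
    simp only [Pi.neg_apply, norm_neg]
  refine abs_le_of_sq_le_sq' ?_ (by positivity) |>.2
  rw [hgrad, mul_pow, Real.sq_sqrt (by positivity)]
  refine hgr.trans ?_
  have hexp : 2 * (2 * τ * growthConst ν L C B) * n = 4 * growthConst ν L C B * T := by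
    rw [hT]; ring
  rw [hexp]
  calc _ ≤ Real.exp (4 * growthConst ν L C B * T) * (2 * sourceConst ν L C B' * ε ^ 2) := by
        gcongr
    _ = _ := by ring
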